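/- \textbf{Setting.} Let $G$ be a locally compact second countable (Hausdorff) unimodular group with a fixed Haar measure $m_G$, and let $(X,\mu,Y)$ be a transverse $G$-space. That is: $X$ is a standard Borel space with a jointly Borel action of $G$; $\mu$ is a $G$-invariant Borel probability measure on $X$; $Y\subseteq X$ is a Borel set such that $G.Y$ is $\mu$-conull, the set $Y_x=\{g\in G: g.x\in Y\}$ is locally finite (meets every compact set in a finite set) for every $x\in G.Y$, and $\int_X|Y_x\cap K|\,d\mu(x)<\infty$ for every compact $K\subseteq G$. For a Borel $G$-space $Z$, a cross section $C$ of $Z$ and a $\sigma$-finite $G$-invariant measure $\lambda$ on $Z$, the transverse measure $\lambda_C$ on $C$ is given by $\lambda_C(f)=\int_Z\sum_{g\in C_z}f(g.z)\,w(g)\,d\lambda(z)$ for Borel $f:C\to[0,\infty]$, where $C_z=\{g\in G:g.z\in C\}$ and $w:G\to[0,\infty]$ is any Borel function with $\int_G w\,dm_G=1$. For an integer $r\ge 1$, let $Y^{[r]}=G.Y^{\otimes r}\subseteq X^{\otimes r}$ (diagonal action), and let $\mu^{[r]}$ be the $\sigma$-finite $G$-invariant measure on $Y^{[r]}$ whose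 transverse measure with respect to the cross section $Y^{\otimes r}$ is $\mu_Y^{\otimes r}$. Put $I^r_\mu(Y)=\mu^{[r]}(Y^{[r]})\in[0,\infty]$. Let $d$ be a right-invariant proper metric on $G$ inducing its topology. An equivariant Voronoi tessellation scheme (for $d$) assigns to every nonempty locally finite set $P\subseteq G$ a partition of $G$ into Borel cells $\Theta(P,p)$, $p\in P$, such that: (1) every point of $\Theta(P,p)$ has $p$ as one of its $d$-nearest points in $P$; (2) $\Theta(Q,p)\subseteq\Theta(P,p)$ whenever $P\subseteq Q$ are locally finite and $p\in P$; (3) $\Theta(Pg,pg)=\Theta(P,p)g$ for all $g\in G$ and $p\in P$; and (4) the scheme is Borel, in the sense that $\{(x,q)\in G\times G: x\in\Theta(\{e_G,q\},e_G)\}$ is a Borel set. \textbf{Proposition (higher order Kac's lemma).} For every transverse $G$-space $(X,\mu,Y)$, every equivariant Voronoi tessellation scheme $\Theta$ and every integer $r\ge 1$, the function $(y_1,\dots,y_r)\mapsto m_G\bigl(\Theta(Y_{y_1}\cap\dots\cap Y_{y_r},e_G)\bigr)$ on $Y^{\otimes r}$ is $\mu_Y^{\otimes r}$-measurable, and \[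 I^r_\mu(Y)=\int_{Y^{\otimes r}}m_G\bigl(\Theta(Y_{y_1}\cap\dots\cap Y_{y_r},e_G)\bigr)\,d\mu_Y^{\otimes r}(y_1,\dots,y_r). \] -/

import Mathlib

open MeasureTheory
open scoped ENNReal Topology

noncomputable section

namespace TransverseKac

/-- A subset of a topological space is locally finite if it meets every compact set in a
finite set. -/
def IsLocFinite {G : Type*} [TopologicalSpace G] (P : Set G) : Prop :=
  ∀ K : Set G, IsCompact K → (P ∩ K).Finite

section Actions

variable (G : Type*) {X : Type*} [Group G] [MulAction G X]

/-- The return times set `Y_x = {g ∈ G : g.x ∈ Y}`. -/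
def returnTimes (Y : Set X) (x : X) : Set G := {g | g • x ∈ Y}

/-- The saturation `G.Y`. -/
def saturation (Y : Set X) : Set X := {x | ∃ g : G, ∃ y ∈ Y, g • y = x}

/-- `Y` is a locally integrable cross section of `(X, μ)`; together with the invariance of the
probability measure `μ` this says that `(X, μ, Y)` is a transverse `G`-space. -/
structure IsLocallyIntegrableCrossSection [TopologicalSpace G] [MeasurableSpace X]
    (μ : Measure X) (Y : Set X) : Prop where
  measurableSet : MeasurableSet Y
  conull : ∀ᵐ x ∂μ, x ∈ saturation G Y
  locFinite : ∀ x ∈ saturation G Y, IsLocFinite (returnTimes G Y x)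
  locIntegrable : ∀ K : Set G, IsCompact K →
    ∫⁻ x, (((returnTimes G Y x ∩ K).encard : ℕ∞) : ℝ≥0∞) ∂μ < ∞

variable {G}

/-- The transverse measure `μ_Y` of an invariant measure `μ`, as a measure on `X` (carried by `Y`):
`μ_Y(f) = ∫_X ∑_{g ∈ Y_x} f(g.x) w(g) dμ(x)`, where `w : G → [0,∞]` is a Borel function whose
integral against the fixed Haar measure of `G` is `1`. -/
def transverseMeasure [MeasurableSpace X] (w : G → ℝ≥0∞) (μ : Measure X) (Y : Set X) :
    Measure X :=
  μ.bind fun x => Measure.sum fun g : returnTimes G Y x => w g • Measure.dirac ((g : G) • x)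

/-- `M` (a measure on `X` carried by the saturation `G.Y`, i.e. a measure on `G.Y`) is `σ`-finite
and `G`-invariant, and its transverse measure with respect to the cross section `Y` of `G.Y`
is `ν`. -/
structure HasTransverseMeasure [MeasurableSpace X] (w : G → ℝ≥0∞) (Y : Set X) (ν M : Measure X) :
    Prop where
  sigmaFinite : SigmaFinite M
  invariant : SMulInvariantMeasure G X M
  carried : ∀ᵐ x ∂M, x ∈ saturation G Y
  transverse_eq : transverseMeasure w M Y = ν

open Classical in
/-- The inverse of the transverse correspondence: the `σ`-finite `G`-invariant measure on `G.Y`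
whose transverse measure is `ν` (and `0` if there is none). -/
def inverseTransverse [MeasurableSpace X] (w : G → ℝ≥0∞) (Y : Set X) (ν : Measure X) :
    Measure X :=
  if h : ∃ M : Measure X, HasTransverseMeasure w Y ν M then h.choose else 0

/-- The power `Y^{⊗r}` in `X^{⊗r}`. -/
def crossPower (Y : Set X) (r : ℕ) : Set (Fin r → X) := Set.univ.pi fun _ => Y

/-- The power `μ_Y^{⊗r}` of the transverse measure. -/
def transversePower [MeasurableSpace X] (w : G → ℝ≥0∞) (μ : Measure X) (Y : Set X) (r : ℕ) :
    Measure (Fin r → X) :=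
  Measure.pi fun _ => transverseMeasure w μ Y

variable (G) in
/-- The intersection space `Y^{[r]} = G.Y^{⊗r}` for the diagonal action of `G` on `X^{⊗r}`. -/
def intersectionSpace (Y : Set X) (r : ℕ) : Set (Fin r → X) := saturation G (crossPower Y r)

/-- The intersection measure `μ^{[r]}`: the `σ`-finite `G`-invariant measure on `Y^{[r]}` whose
transverse measure with respect to the cross section `Y^{⊗r}` is `μ_Y^{⊗r}`. -/
def intersectionMeasure [MeasurableSpace X] (w : G → ℝ≥0∞) (μ : Measure X) (Y : Set X) (r : ℕ) :
    Measure (Fin r → X) :=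
  inverseTransverse w (crossPower Y r) (transversePower w μ Y r)

/-- The intersection covolume `I^r_μ(Y) = μ^{[r]}(Y^{[r]})`. -/
def intersectionCovolume [MeasurableSpace X] (w : G → ℝ≥0∞) (μ : Measure X) (Y : Set X) (r : ℕ) :
    ℝ≥0∞ :=
  intersectionMeasure w μ Y r (intersectionSpace G Y r)

end Actions

section Voronoi

variable {G : Type*} [Group G] [TopologicalSpace G]

/-- A compatible metric on `G`: a right-invariant proper metric inducing the topology of `G`. -/
structure IsCompatibleMetric (d : G → G → ℝ) : Prop where
  eq_zero_iff : ∀ x y, d x y = 0 ↔ x = y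
  symm : ∀ x y, d x y = d y x
  triangle : ∀ x y z, d x z ≤ d x y + d y z
  right_invariant : ∀ x y g, d (x * g) (y * g) = d x y
  proper : ∀ (x : G) (R : ℝ), IsCompact {y | d x y ≤ R}
  mem_nhds_iff : ∀ (x : G) (s : Set G), s ∈ 𝓝 x ↔ ∃ ε > 0, {y | d x y < ε} ⊆ s

/-- An equivariant Voronoi tessellation scheme for the metric `d`: it assigns to each nonempty
locally finite `P ⊆ G` a partition of `G` into Borel cells `Θ P p`, `p ∈ P`, such that `p` is a
nearest point of `P` to every point of `Θ P p`, cells shrink when `P` grows, and the scheme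
commutes with right translations. The field `borel` says that the scheme is Borel as a function of
the configuration; it only has to be required for the configurations `{e, q}`, because the cells
of two-point configurations determine all cells. -/
structure IsVoronoiScheme [MeasurableSpace G] (d : G → G → ℝ) (Θ : Set G → G → Set G) :
    Prop where
  measurableSet_cell : ∀ P : Set G, IsLocFinite P → ∀ p ∈ P, MeasurableSet (Θ P p)
  partition : ∀ P : Set G, IsLocFinite P → P.Nonempty → ∀ x : G, ∃! p : G, p ∈ P ∧ x ∈ Θ P p
  nearest : ∀ P : Set G, IsLocFinite P → ∀ p ∈ P, ∀ x ∈ Θ P p, ∀ q ∈ P, d x p ≤ d x q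
  anti : ∀ P Q : Set G, IsLocFinite P → IsLocFinite Q → P ⊆ Q → ∀ p ∈ P, Θ Q p ⊆ Θ P p
  equivariant : ∀ P : Set G, IsLocFinite P → ∀ p ∈ P, ∀ g : G,
    Θ ((fun x => x * g) '' P) (p * g) = (fun x => x * g) '' Θ P p
  borel : MeasurableSet {t : G × G | t.1 ∈ Θ {1, t.2} 1}

end Voronoi

end TransverseKac

end

/-! Write `C` for the cross section, here a power of `Y`. For an invariant measure `κ`, the Campbell
formula equates `∫ ∑ F(g, g.z) dκ(z)`, the sum running over the return times of `z` to `C`, with the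
integral of `F` against Haar measure times the transverse measure. Take for `F` the Voronoi weight:
`F(g, y) = 1` if `g⁻¹` lies in the cell of `e` among the return times of `y`, and `0` otherwise. By
equivariance, `F(g, g.z) = 1` exactly when `e` lies in the cell of `g` among the return times of
`z`, so the sum is `1` because the cells partition `G`. The inner Haar integral of `F` is the volume
of the cell of `e`. This is Kac's formula (`measure_saturation_eq_lintegral`).

It remains to see that the intersection measure exists. Transverse measures satisfy a mass transport
principle (`massTransport_transverseMeasure`), which passes to powers (`MassTransport.pi`).
Conversely, a finite measure on `C` with mass transport is the transverse measure of an invariant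
measure, built from any Borel weight summing to `1` along return times
(`hasTransverseMeasure_inducedMeasure`). The Voronoi weight serves again.

All sums run formally over the whole group. Their measurability comes from splitting Borel sets with
discrete sections into countably many Borel graphs, which is deduced from Novikov's separation
theorem. -/

noncomputable section

namespace TransverseKac

/-! ### Novikov separation of sequences of analytic sets. -/

section Separation

variable {α : Type*}

/-- The image under `f n` of the sequences whose digits are prescribed by the first `k` entries of
`v`, where the digit `j` of the `n`-th sequence is stored at `Nat.pair n j`. -/
def prescribedImage (f : ℕ → (ℕ → ℕ) → α) (v : ℕ → ℕ) (k n : ℕ) : Set α :=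
  f n '' {y | ∀ j, Nat.pair n j < k → y j = v (Nat.pair n j)}

theorem prescribedImage_congr {f : ℕ → (ℕ → ℕ) → α} {v v' : ℕ → ℕ} {k : ℕ}
    (h : ∀ i < k, v i = v' i) : prescribedImage f v k = prescribedImage f v' k := by
  funext n
  unfold prescribedImage
  congr 1
  ext y
  refine forall_congr' fun j => forall_congr' fun hj => ?_
  rw [h _ hj]

theorem eventually_prescribedImage_subset [TopologicalSpace α] {f : ℕ → (ℕ → ℕ) → α} {n : ℕ}
    (hf : Continuous (f n)) (v : ℕ → ℕ) {U : Set α} (hU : IsOpen U)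
    (hx : f n (fun j => v (Nat.pair n j)) ∈ U) :
    ∀ᶠ k in Filter.atTop, prescribedImage f v k n ⊆ U := by
  have hnhds : f n ⁻¹' U ∈ 𝓝 (fun j => v (Nat.pair n j)) :=
    hf.continuousAt.preimage_mem_nhds (hU.mem_nhds hx)
  rw [nhds_pi, Filter.mem_pi] at hnhds
  obtain ⟨I, hI, t, ht, hIt⟩ := hnhds
  have hev : ∀ j ∈ I, ∀ᶠ k in Filter.atTop, Nat.pair n j < k :=
    fun j _ => Filter.eventually_gt_atTop _
  filter_upwards [(Filter.eventually_all_finite hI).2 hev] with k hk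
  rintro _ ⟨y, hy, rfl⟩
  refine hIt fun j hj => ?_
  rw [hy j (hk j hj)]
  exact mem_of_mem_nhds (ht j)

variable [MeasurableSpace α]

/-- A sequence of sets is jointly Borel separable if its members can be enlarged to measurable
sets whose intersection is still empty. -/
def JointlySeparable (A : ℕ → Set α) : Prop :=
  ∃ B : ℕ → Set α, (∀ n, A n ⊆ B n) ∧ (∀ n, MeasurableSet (B n)) ∧ ⋂ n, B n = ∅

/-- Take the union over the pieces of the enlargements in coordinate `n₀` and their intersection in
every other coordinate: a common point would lie in all the enlargements of a single piece. -/
theorem JointlySeparable.of_iUnion {A : ℕ → Set α} {n₀ : ℕ} (A' : ℕ → ℕ → Set α)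
    (h₀ : A n₀ ⊆ ⋃ c, A' c n₀) (h : ∀ c n, n ≠ n₀ → A n ⊆ A' c n)
    (hA' : ∀ c, JointlySeparable (A' c)) : JointlySeparable A := by
  choose B hAB hB hB' using hA'
  refine ⟨fun n => if n = n₀ then ⋃ c, B c n else ⋂ c, B c n, fun n => ?_, fun n => ?_, ?_⟩
  · dsimp only
    split_ifs with hn
    · subst hn
      exact h₀.trans (Set.iUnion_mono fun c => hAB c n)
    · exact Set.subset_iInter fun c => (h c n hn).trans (hAB c n)
  · dsimp only
    split_ifs
    · exact MeasurableSet.iUnion fun c => hB c n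
    · exact MeasurableSet.iInter fun c => hB c n
  · refine Set.eq_empty_iff_forall_notMem.2 fun x hx => ?_
    have hx₀ := Set.mem_iInter.1 hx n₀
    rw [if_pos rfl] at hx₀
    obtain ⟨c, hc⟩ := Set.mem_iUnion.1 hx₀
    refine Set.eq_empty_iff_forall_notMem.1 (hB' c) x (Set.mem_iInter.2 fun n => ?_)
    by_cases hn : n = n₀
    · exact hn ▸ hc
    · have := Set.mem_iInter.1 hx n
      rw [if_neg hn] at this
      exact Set.mem_iInter.1 this c

/-- Stage `k` fixes digit `k.unpair.2` of sequence number `k.unpair.1`. Only one set is split per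
stage, into countably many pieces, yet every digit of every sequence is fixed eventually. -/
theorem exists_not_jointlySeparable_update {f : ℕ → (ℕ → ℕ) → α} {v : ℕ → ℕ} {k : ℕ}
    (h : ¬ JointlySeparable (prescribedImage f v k)) :
    ∃ c, ¬ JointlySeparable (prescribedImage f (Function.update v k c) (k + 1)) := by
  by_contra! H
  refine h (JointlySeparable.of_iUnion (n₀ := k.unpair.1)
    (fun c => prescribedImage f (Function.update v k c) (k + 1)) ?_ ?_ H)
  · rintro _ ⟨y, hy, rfl⟩
    refine Set.mem_iUnion.2 ⟨y k.unpair.2, y, fun j hj => ?_, rfl⟩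
    rcases (Nat.lt_succ_iff.1 hj).lt_or_eq with hlt | heq
    · rw [Function.update_of_ne hlt.ne]
      exact hy j hlt
    · rw [heq, Function.update_self, ← heq, Nat.unpair_pair]
  · rintro c n hn _ ⟨y, hy, rfl⟩
    refine ⟨y, fun j hj => ?_, rfl⟩
    rcases (Nat.lt_succ_iff.1 hj).lt_or_eq with hlt | heq
    · rw [Function.update_of_ne hlt.ne]
      exact hy j hlt
    · exact absurd (by rw [← heq, Nat.unpair_pair]) hn

theorem exists_forall_not_jointlySeparable {f : ℕ → (ℕ → ℕ) → α}
    (h : ¬ JointlySeparable fun n => Set.range (f n)) :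
    ∃ v : ℕ → ℕ, ∀ k, ¬ JointlySeparable (prescribedImage f v k) := by
  have step : ∀ (v : ℕ → ℕ) (k : ℕ), ∃ c, ¬ JointlySeparable (prescribedImage f v k) →
      ¬ JointlySeparable (prescribedImage f (Function.update v k c) (k + 1)) := by
    intro v k
    by_cases hv : JointlySeparable (prescribedImage f v k)
    · exact ⟨0, fun h => absurd hv h⟩
    · obtain ⟨c, hc⟩ := exists_not_jointlySeparable_update hv
      exact ⟨c, fun _ => hc⟩
  choose c hc using step
  let V : ℕ → ℕ → ℕ := fun k => Nat.rec (fun _ => 0) (fun k v => Function.update v k (c v k)) k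
  have hV : ∀ k, V (k + 1) = Function.update (V k) k (c (V k) k) := fun k => rfl
  have hsep : ∀ k, ¬ JointlySeparable (prescribedImage f (V k) k) := by
    intro k
    induction k with
    | zero =>
      convert! h using 2
      funext n
      simp [prescribedImage]
    | succ k ih =>
      rw [hV]
      exact hc _ _ ih
  have hstat : ∀ i k, i < k → V k i = V (i + 1) i := by
    intro i k hik
    induction k, Nat.succ_le_of_lt hik using Nat.le_induction with
    | base => rfl
    | succ k hk ih =>
      rw [hV, Function.update_of_ne (by omega)]
      exact ih (by omega)
  refine ⟨fun i => V (i + 1) i, fun k => ?_⟩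
  rw [prescribedImage_congr (v' := V k) fun i hi => (hstat i k hi).symm]
  exact hsep k

/-- Novikov's separation theorem: a sequence of analytic sets with empty intersection can be
enlarged to a sequence of Borel sets with empty intersection. -/
theorem jointlySeparable_of_analyticSet [TopologicalSpace α] [T2Space α] [OpensMeasurableSpace α]
    {A : ℕ → Set α} (hA : ∀ n, AnalyticSet (A n)) (h : ⋂ n, A n = ∅) : JointlySeparable A := by
  by_cases hne : ∃ n, A n = ∅
  · obtain ⟨n₀, hn₀⟩ := hne
    refine ⟨fun n => if n = n₀ then ∅ else Set.univ, fun n => ?_, fun n => ?_, ?_⟩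
    · dsimp only
      split_ifs with hn
      · rw [hn, hn₀]
      · exact Set.subset_univ _
    · dsimp only
      split_ifs
      exacts [MeasurableSet.empty, MeasurableSet.univ]
    · exact Set.eq_empty_of_subset_empty fun x hx => by simpa using Set.mem_iInter.1 hx n₀
  push Not at hne
  have hf : ∀ n, ∃ f : (ℕ → ℕ) → α, Continuous f ∧ Set.range f = A n := fun n =>
    ((AnalyticSet_def (A n)).mp (hA n)).resolve_left (hne n).ne_empty
  choose f hf hfA using hf
  obtain rfl : (fun n => Set.range (f n)) = A := funext hfA
  by_contra hsep
  obtain ⟨v, hv⟩ := exists_forall_not_jointlySeparable hsep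
  -- The inseparable branch `v` picks one point from each set. They cannot all coincide, and
  -- disjoint neighbourhoods of two different ones separate a late stage of the branch.
  have hdiff : ∃ n, f n (fun j => v (Nat.pair n j)) ≠ f 0 (fun j => v (Nat.pair 0 j)) := by
    by_contra! H
    exact h.subset (Set.mem_iInter.2 fun n => ⟨_, H n⟩)
  obtain ⟨n, hn⟩ := hdiff
  obtain ⟨U, W, hU, hW, hxU, hxW, hUW⟩ := t2_separation hn
  obtain ⟨k, hkU, hkW⟩ := ((eventually_prescribedImage_subset (hf n) v hU hxU).and
    (eventually_prescribedImage_subset (hf 0) v hW hxW)).exists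
  have hn0 : n ≠ 0 := by
    rintro rfl
    exact hn rfl
  refine hv k ⟨fun i => if i = n then U else if i = 0 then W else Set.univ, fun i => ?_,
    fun i => ?_, ?_⟩
  · dsimp only
    split_ifs with h₁ h₂
    · exact h₁ ▸ hkU
    · exact h₂ ▸ hkW
    · exact Set.subset_univ _
  · dsimp only
    split_ifs
    exacts [hU.measurableSet, hW.measurableSet, MeasurableSet.univ]
  · refine Set.eq_empty_of_subset_empty fun x hx => ?_
    have h₁ := Set.mem_iInter.1 hx n
    have h₂ := Set.mem_iInter.1 hx 0
    rw [if_pos rfl] at h₁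
    rw [if_neg hn0.symm, if_pos rfl] at h₂
    exact Set.disjoint_left.1 hUW h₁ h₂

end Separation

/-! ### Borel sets with discrete sections. -/

section Uniformization

variable {Z G : Type*} [MeasurableSpace Z] [StandardBorelSpace Z]
  [TopologicalSpace G] [SecondCountableTopology G] [MeasurableSpace G] [BorelSpace G]
  [StandardBorelSpace G]

/-- A Borel set with discrete sections is a countable union of Borel sets whose sections have at
most one point. -/
theorem exists_iUnion_injOn_fst {A : Set (Z × G)} (hA : MeasurableSet A)
    (hdisc : ∀ z g, (z, g) ∈ A → ∃ U ∈ 𝓝 g, ∀ h ∈ U, (z, h) ∈ A → h = g) :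
    ∃ B : ℕ → Set (Z × G), (∀ n, MeasurableSet (B n)) ∧ A = ⋃ n, B n ∧
      ∀ n, Set.InjOn Prod.fst (B n) := by
  obtain ⟨U, hU⟩ := TopologicalSpace.exists_countable_basis G
  obtain ⟨hUc, -, hUb⟩ := hU
  have hne : (U ∪ {Set.univ}).Nonempty := ⟨Set.univ, Or.inr rfl⟩
  obtain ⟨u, hu⟩ := (hUc.union (Set.countable_singleton Set.univ)).exists_eq_range hne
  have huo : ∀ n, IsOpen (u n) := by
    intro n
    have : u n ∈ U ∪ {Set.univ} := hu ▸ Set.mem_range_self n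
    rcases this with h | h
    · exact hUb.isOpen h
    · rw [Set.mem_singleton_iff.1 h]
      exact isOpen_univ
  -- `D n` consists of the points of `A` that `u n` does not isolate in their section. It is
  -- analytic, and discreteness of the sections makes the intersection of all `D n` empty.
  let D : ℕ → Set (Z × G) := fun n => A ∩ {p | p.2 ∉ u n} ∪
    Prod.fst '' {q : (Z × G) × G | q.1 ∈ A ∧ (q.1.1, q.2) ∈ A ∧ q.2 ∈ u n ∧ q.2 ≠ q.1.2}
  have hD₁ : ∀ n, MeasurableSet (A ∩ {p | p.2 ∉ u n}) := fun n =>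
    hA.inter (measurable_snd (huo n).measurableSet.compl)
  have hD₂ : ∀ n, MeasurableSet
      {q : (Z × G) × G | q.1 ∈ A ∧ (q.1.1, q.2) ∈ A ∧ q.2 ∈ u n ∧ q.2 ≠ q.1.2} := by
    intro n
    refine (measurable_fst hA).inter (MeasurableSet.inter ?_ (MeasurableSet.inter ?_ ?_))
    · exact ((measurable_fst.fst).prodMk measurable_snd) hA
    · exact measurable_snd (huo n).measurableSet
    · exact (measurableSet_eq_fun measurable_snd (measurable_snd.comp measurable_fst)).compl
  have hempty : ⋂ n, D n = ∅ := by
    refine Set.eq_empty_iff_forall_notMem.2 fun ⟨z, g⟩ hzg => ?_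
    have hzA : (z, g) ∈ A := by
      rcases Set.mem_iInter.1 hzg 0 with h | ⟨q, hq, hqe⟩
      · exact h.1
      · exact hqe ▸ hq.1
    obtain ⟨V, hV, hVA⟩ := hdisc z g hzA
    obtain ⟨W, hWU, hgW, hWV⟩ := hUb.mem_nhds_iff.1 hV
    obtain ⟨n, rfl⟩ : W ∈ Set.range u := hu ▸ Or.inl hWU
    rcases Set.mem_iInter.1 hzg n with h | ⟨q, ⟨-, hq₂, hq₃, hq₄⟩, hqe⟩
    · exact h.2 hgW
    · rw [hqe] at hq₂ hq₄
      exact hq₄ (hVA _ (hWV hq₃) hq₂)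
  obtain ⟨C, hDC, hC, hCe⟩ : JointlySeparable D := by
    let := upgradeStandardBorel (Z × G)
    refine jointlySeparable_of_analyticSet (fun n => ?_) hempty
    have h₁ := (hD₁ n).analyticSet
    have h₂ := (hD₂ n).analyticSet_image (f := Prod.fst) measurable_fst
    rw [show D n = ⋃ b : Bool, cond b (A ∩ {p | p.2 ∉ u n}) (Prod.fst ''
      {q : (Z × G) × G | q.1 ∈ A ∧ (q.1.1, q.2) ∈ A ∧ q.2 ∈ u n ∧ q.2 ≠ q.1.2}) from
      Set.union_eq_iUnion]
    refine AnalyticSet.iUnion fun b => ?_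
    cases b
    exacts [h₂, h₁]
  refine ⟨fun n => A \ C n, fun n => hA.diff (hC n), ?_, fun n => ?_⟩
  · rw [← Set.sdiff_iInter, hCe, Set.sdiff_empty]
  · rintro ⟨z, g⟩ ⟨hg, hgC⟩ ⟨z', h⟩ ⟨hh, hhC⟩ hzz
    obtain rfl : z = z' := hzz
    by_contra hne
    refine hgC (hDC n (Or.inr ⟨((z, g), h), ⟨hg, hh, ?_, fun e => hne ?_⟩, rfl⟩))
    · by_contra hu'
      exact hhC (hDC n (Or.inl ⟨hh, hu'⟩))
    · rw [show h = g from e]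

/-- Summation over the discrete sections of a Borel set preserves measurability. -/
theorem measurable_tsum_indicator_section [Nonempty G] {A : Set (Z × G)} (hA : MeasurableSet A)
    (hdisc : ∀ z g, (z, g) ∈ A → ∃ U ∈ 𝓝 g, ∀ h ∈ U, (z, h) ∈ A → h = g)
    {β : Type*} [MeasurableSpace β] {φ : β → Z} (hφ : Measurable φ) {f : β → G → ℝ≥0∞}
    (hf : Measurable (Function.uncurry f)) :
    Measurable fun b => ∑' g, A.indicator (fun p => f b p.2) (φ b, g) := by
  obtain ⟨B', hB', hAB', hinj'⟩ := exists_iUnion_injOn_fst hA hdisc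
  let B := disjointed B'
  have hB : ∀ n, MeasurableSet (B n) := fun n => MeasurableSet.disjointed hB' n
  have hAB : A = ⋃ n, B n := by rw [hAB', iUnion_disjointed]
  have hinj : ∀ n, Set.InjOn Prod.fst (B n) := fun n => (hinj' n).mono (disjointed_subset B' n)
  -- By Lusin–Souslin the injective projection of `B n` is a measurable embedding, so the unique
  -- section point depends measurably on the base point. Off the projection the value of `s` is
  -- irrelevant.
  have hsel : ∀ n, ∃ s : Z → G, Measurable s ∧ ∀ z g, (z, g) ∈ B n → s z = g := by
    intro n
    have : StandardBorelSpace (B n) := (hB n).standardBorel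
    have hemb : MeasurableEmbedding (fun p : B n => (p : Z × G).1) :=
      Measurable.measurableEmbedding (measurable_fst.comp measurable_subtype_coe)
        ((hinj n).injective)
    obtain ⟨s, hs, hse⟩ := hemb.exists_measurable_extend
      (g := fun p : B n => (p : Z × G).2) (measurable_snd.comp measurable_subtype_coe)
      (fun _ => inferInstance)
    exact ⟨s, hs, fun z g h => congrFun hse ⟨(z, g), h⟩⟩
  choose s hs hse using hsel
  have key : ∀ b, ∑' g, A.indicator (fun p => f b p.2) (φ b, g) =
      ∑' n, (B n).indicator (fun p => f b p.2) (φ b, s n (φ b)) := by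
    intro b
    have h₁ : ∀ p, A.indicator (fun p => f b p.2) p =
        ∑' n, (B n).indicator (fun p => f b p.2) p := by
      intro p
      by_cases hp : p ∈ A
      · obtain ⟨n, hn⟩ := Set.mem_iUnion.1 (hAB ▸ hp)
        rw [Set.indicator_of_mem hp, tsum_eq_single n fun k hk => Set.indicator_of_notMem
          (fun hpk => Set.disjoint_left.1 (disjoint_disjointed B' hk) hpk hn) _,
          Set.indicator_of_mem hn]
      · rw [Set.indicator_of_notMem hp]
        refine (ENNReal.tsum_eq_zero.2 fun n => Set.indicator_of_notMem (fun hpn => hp ?_) _).symm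
        exact hAB ▸ Set.mem_iUnion.2 ⟨n, hpn⟩
    simp_rw [h₁]
    rw [ENNReal.tsum_comm]
    refine tsum_congr fun n => tsum_eq_single _ fun g hg => ?_
    exact Set.indicator_of_notMem (fun hmem => hg (hse n _ _ hmem).symm) _
  simp_rw [key]
  refine Measurable.tsum fun n => ?_
  have hpair : Measurable fun b => (φ b, s n (φ b)) := hφ.prodMk ((hs n).comp hφ)
  have : (fun b => (B n).indicator (fun p => f b p.2) (φ b, s n (φ b))) =
      ((fun b => (φ b, s n (φ b))) ⁻¹' B n).indicator fun b => f b (s n (φ b)) := rfl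
  rw [this]
  exact (hf.comp (measurable_id.prodMk ((hs n).comp hφ))).indicator (hpair (hB n))

end Uniformization

section LocFinite

variable {G : Type*} [TopologicalSpace G]

theorem IsLocFinite.mono {P Q : Set G} (hQ : IsLocFinite Q) (h : P ⊆ Q) : IsLocFinite P :=
  fun K hK => (hQ K hK).subset (Set.inter_subset_inter_left K h)

theorem IsLocFinite.countable [SigmaCompactSpace G] {P : Set G} (hP : IsLocFinite P) :
    P.Countable := by
  rw [← Set.inter_univ P, ← iUnion_compactCovering, Set.inter_iUnion]
  exact Set.countable_iUnion fun n => (hP _ (isCompact_compactCovering G n)).countable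

theorem IsLocFinite.exists_nhds_isolating [LocallyCompactSpace G] [T2Space G] {P : Set G}
    (hP : IsLocFinite P) (g : G) : ∃ U ∈ 𝓝 g, ∀ h ∈ U, h ∈ P → h = g := by
  obtain ⟨K, hK, hgK⟩ := exists_compact_mem_nhds g
  refine ⟨K ∩ ((P ∩ K) \ {g})ᶜ, Filter.inter_mem hgK ?_, fun h hh hP' => ?_⟩
  · have hfin : ((P ∩ K) \ {g}).Finite := (hP K hK).subset Set.sdiff_subset
    exact hfin.isClosed.isOpen_compl.mem_nhds fun h => h.2 rfl
  · by_contra hne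
    exact hh.2 ⟨⟨hP', hh.1⟩, hne⟩

end LocFinite

/-! ### Algebra of sums over return times. -/

section SectionSum

variable {G Z : Type*} [Group G] [MulAction G Z]

/-- The sum of `f g (g • z)` over the return times `g` of `z` to `C`. -/
def sectionSum (C : Set Z) (f : G → Z → ℝ≥0∞) (z : Z) : ℝ≥0∞ :=
  ∑' g : G, C.indicator (f g) (g • z)

theorem sectionSum_congr {C : Set Z} {f f' : G → Z → ℝ≥0∞} {z : Z}
    (h : ∀ g, g • z ∈ C → f g (g • z) = f' g (g • z)) : sectionSum C f z = sectionSum C f' z := by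
  refine tsum_congr fun g => ?_
  by_cases hg : g • z ∈ C
  · rw [Set.indicator_of_mem hg, Set.indicator_of_mem hg, h g hg]
  · rw [Set.indicator_of_notMem hg, Set.indicator_of_notMem hg]

theorem sectionSum_smul (C : Set Z) (f : G → Z → ℝ≥0∞) (h : G) (z : Z) :
    sectionSum C f (h • z) = sectionSum C (fun k => f (k * h⁻¹)) z := by
  unfold sectionSum
  rw [← (Equiv.mulRight h⁻¹).tsum_eq]
  refine tsum_congr fun k => ?_
  simp [smul_smul]

theorem sectionSum_const_mul (C : Set Z) (f : G → Z → ℝ≥0∞) (a : ℝ≥0∞) (z : Z) :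
    sectionSum C (fun g y => a * f g y) z = a * sectionSum C f z := by
  unfold sectionSum
  rw [← ENNReal.tsum_mul_left]
  refine tsum_congr fun g => ?_
  by_cases hg : g • z ∈ C
  · rw [Set.indicator_of_mem hg, Set.indicator_of_mem hg]
  · rw [Set.indicator_of_notMem hg, Set.indicator_of_notMem hg, mul_zero]

theorem indicator_tsum_apply {ι α : Type*} (C : Set α) (f : ι → α → ℝ≥0∞) (x : α) :
    C.indicator (fun y => ∑' i, f i y) x = ∑' i, C.indicator (f i) x := by
  by_cases hx : x ∈ C <;> simp [hx]

/-- Double sums over pairs of return times can be interchanged. -/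
theorem sectionSum_comm (C : Set Z) (A : G → G → Z → Z → ℝ≥0∞) (z : Z) :
    sectionSum C (fun h y => sectionSum C (fun g y' => A h (g * h) y y') y) z =
      sectionSum C (fun k y' => sectionSum C (fun g y => A (g * k) k y y') y') z := by
  have h₁ : ∀ h, C.indicator (fun y => sectionSum C (fun g y' => A h (g * h) y y') y) (h • z) =
      ∑' k, C.indicator (fun y => C.indicator (fun y' => A h k y y') (k • z)) (h • z) := by
    intro h
    rw [← indicator_tsum_apply]
    by_cases hh : h • z ∈ C
    · rw [Set.indicator_of_mem hh, Set.indicator_of_mem hh, sectionSum_smul]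
      simp [sectionSum]
    · rw [Set.indicator_of_notMem hh, Set.indicator_of_notMem hh]
  have h₂ : ∀ k, C.indicator (fun y' => sectionSum C (fun g y => A (g * k) k y y') y') (k • z) =
      ∑' h, C.indicator (fun y => C.indicator (fun y' => A h k y y') (k • z)) (h • z) := by
    intro k
    by_cases hk : k • z ∈ C
    · rw [Set.indicator_of_mem hk, sectionSum_smul]
      simp [sectionSum, Set.indicator_of_mem hk]
    · rw [Set.indicator_of_notMem hk]
      simp [Set.indicator_of_notMem hk]
  unfold sectionSum at h₁ h₂ ⊢
  simp_rw [h₁, h₂]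
  exact ENNReal.tsum_comm

theorem mem_saturation_iff {C : Set Z} {z : Z} : z ∈ saturation G C ↔ ∃ g : G, g • z ∈ C := by
  constructor
  · rintro ⟨g, y, hy, rfl⟩
    exact ⟨g⁻¹, by rwa [inv_smul_smul]⟩
  · rintro ⟨g, hg⟩
    exact ⟨g⁻¹, _, hg, inv_smul_smul g z⟩

theorem smul_mem_saturation {C : Set Z} {z : Z} (hz : z ∈ C) (g : G) :
    g • z ∈ saturation G C := ⟨g, z, hz, rfl⟩

theorem sectionSum_eq_zero_iff {C : Set Z} {f : G → Z → ℝ≥0∞} {z : Z} :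
    sectionSum C f z = 0 ↔ ∀ g, g • z ∈ C → f g (g • z) = 0 := by
  simp [sectionSum, ENNReal.tsum_eq_zero]

end SectionSum

/-! ### Measurability and integration of sums over return times. -/

section Measurability

/-- A Borel set all of whose sets of return times are locally finite. -/
structure IsLocFiniteSection (G : Type*) {Z : Type*} [Group G] [TopologicalSpace G]
    [MeasurableSpace Z] [MulAction G Z] (C : Set Z) : Prop where
  measurableSet : MeasurableSet C
  locFinite : ∀ z, IsLocFinite (returnTimes G C z)

variable {G Z : Type*} [Group G] [TopologicalSpace G] [LocallyCompactSpace G]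
  [SecondCountableTopology G] [MeasurableSpace Z] [MulAction G Z]

theorem lintegral_sectionSum {C : Set Z} (hC : IsLocFiniteSection G C) {β : Type*}
    [MeasurableSpace β] (ρ : Measure β) {f : β → G → Z → ℝ≥0∞} (z : Z)
    (hf : ∀ g, Measurable fun b => f b g (g • z)) :
    ∫⁻ b, sectionSum C (f b) z ∂ρ = sectionSum C (fun g y => ∫⁻ b, f b g y ∂ρ) z := by
  have : Countable (returnTimes G C z) := (hC.locFinite z).countable.to_subtype
  have key : ∀ f : G → Z → ℝ≥0∞,
      sectionSum C f z = ∑' g : returnTimes G C z, f g ((g : G) • z) := by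
    intro f
    rw [tsum_subtype (returnTimes G C z) fun g => f g (g • z)]
    rfl
  simp_rw [key]
  exact lintegral_tsum fun g => (hf g).aemeasurable

variable [T2Space G] [MeasurableSpace G] [BorelSpace G]
  [StandardBorelSpace G] [StandardBorelSpace Z] [MeasurableSMul₂ G Z]

theorem measurable_sectionSum {C : Set Z} (hC : IsLocFiniteSection G C) {β : Type*}
    [MeasurableSpace β] {φ : β → Z} (hφ : Measurable φ) {f : β → G → Z → ℝ≥0∞}
    (hf : Measurable fun p : β × G × Z => f p.1 p.2.1 p.2.2) :
    Measurable fun b => sectionSum C (f b) (φ b) := by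
  have hA : MeasurableSet {p : Z × G | p.2 • p.1 ∈ C} :=
    (measurable_snd.smul measurable_fst) hC.measurableSet
  refine measurable_tsum_indicator_section (G := G) hA (fun z g _ => ?_) hφ
    (f := fun b g => f b g (g • φ b)) ?_
  · exact (hC.locFinite z).exists_nhds_isolating g
  · exact hf.comp (measurable_fst.prodMk (measurable_snd.prodMk
      (measurable_snd.smul (hφ.comp measurable_fst))))

theorem measurable_sectionSum_uncurry {C : Set Z} (hC : IsLocFiniteSection G C)
    {f : G → Z → ℝ≥0∞} (hf : Measurable (Function.uncurry f)) : Measurable (sectionSum C f) :=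
  measurable_sectionSum hC measurable_id (f := fun _ => f) (hf.comp measurable_snd)

/-- A saturation is a projection, hence a priori only analytic; here it is where the Borel count of
return times is nonzero. -/
theorem measurableSet_saturation {C : Set Z} (hC : IsLocFiniteSection G C) :
    MeasurableSet (saturation G C) := by
  have h : Measurable (sectionSum C fun (_ : G) _ => 1) :=
    measurable_sectionSum_uncurry hC measurable_const
  have : saturation G C = {z | sectionSum C (fun (_ : G) _ => 1) z = 0}ᶜ := by
    ext z
    simp [mem_saturation_iff, sectionSum_eq_zero_iff]
  rw [this]
  exact (h (measurableSet_singleton 0)).compl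

/-- The formula for integrals against a `bind` needs a measurable kernel, which
`measurable_sectionSum_uncurry` provides. -/
theorem lintegral_transverseMeasure {C : Set Z} (hC : IsLocFiniteSection G C) {w : G → ℝ≥0∞}
    (hw : Measurable w) (κ : Measure Z) {f : Z → ℝ≥0∞} (hf : Measurable f) :
    ∫⁻ y, f y ∂(transverseMeasure w κ C) =
      ∫⁻ z, sectionSum C (fun g y => w g * f y) z ∂κ := by
  have key : ∀ (f : Z → ℝ≥0∞), Measurable f → ∀ z,
      ∫⁻ y, f y ∂(Measure.sum fun g : returnTimes G C z => w g • Measure.dirac ((g : G) • z)) =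
        sectionSum C (fun g y => w g * f y) z := by
    intro f hf z
    rw [lintegral_sum_measure]
    simp_rw [lintegral_smul_measure, lintegral_dirac' _ hf, smul_eq_mul]
    rw [tsum_subtype (returnTimes G C z) fun g => w g * f (g • z)]
    rfl
  unfold transverseMeasure
  rw [Measure.lintegral_bind _ hf.aemeasurable]
  · exact lintegral_congr fun z => key f hf z
  · refine (Measure.measurable_of_measurable_coe _ fun s hs => ?_).aemeasurable
    have hs' : Measurable (s.indicator (1 : Z → ℝ≥0∞)) := measurable_one.indicator hs
    simp_rw [← lintegral_indicator_one hs, key _ hs']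
    exact measurable_sectionSum_uncurry hC
      ((hw.comp measurable_fst).mul (hs'.comp measurable_snd))

theorem ae_mem_transverseMeasure {C : Set Z} (hC : IsLocFiniteSection G C) {w : G → ℝ≥0∞}
    (hw : Measurable w) (κ : Measure Z) : ∀ᵐ y ∂(transverseMeasure w κ C), y ∈ C := by
  rw [ae_iff]
  change transverseMeasure w κ C Cᶜ = 0
  rw [← lintegral_indicator_one hC.measurableSet.compl,
    lintegral_transverseMeasure hC hw κ (measurable_one.indicator hC.measurableSet.compl)]
  refine lintegral_eq_zero_of_ae_eq_zero (Filter.Eventually.of_forall fun z => ?_)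
  refine sectionSum_eq_zero_iff.2 fun g hg => ?_
  simp [hg]

end Measurability

/-! ### Campbell formula and mass transport for transverse measures. -/

section Campbell

theorem measurable_uncurry_apply {α β γ δ : Type*} [MeasurableSpace α] [MeasurableSpace β]
    [MeasurableSpace γ] [MeasurableSpace δ] {F : α → β → γ} (hF : Measurable (Function.uncurry F))
    {a : δ → α} {b : δ → β} (ha : Measurable a) (hb : Measurable b) :
    Measurable fun p => F (a p) (b p) :=
  hF.comp (ha.prodMk hb)

theorem lintegral_mul_inv_eq_one {G : Type*} [Group G] [MeasurableSpace G] [MeasurableMul G]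
    [MeasurableInv G] (m : Measure G) [m.IsMulLeftInvariant] [m.IsInvInvariant] {w : G → ℝ≥0∞}
    (hw_one : ∫⁻ g, w g ∂m = 1) (k : G) :
    ∫⁻ g, w (k * g⁻¹) ∂m = 1 := by
  rw [lintegral_inv_eq_self (μ := m) (fun g => w (k * g)), lintegral_mul_left_eq_self, hw_one]

variable {G Z : Type*} [Group G] [TopologicalSpace G] [IsTopologicalGroup G]
  [LocallyCompactSpace G] [SecondCountableTopology G] [T2Space G] [MeasurableSpace G]
  [BorelSpace G] [StandardBorelSpace G]
  [MeasurableSpace Z] [StandardBorelSpace Z] [MulAction G Z] [MeasurableSMul₂ G Z]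
  (m : Measure G) [m.IsHaarMeasure] [m.IsInvInvariant]

/-- The Campbell formula: the transverse measure disintegrates the counting measure of the return
times along the Haar measure. -/
theorem lintegral_sectionSum_eq_lintegral_transverseMeasure {C : Set Z}
    (hC : IsLocFiniteSection G C) {w : G → ℝ≥0∞} (hw : Measurable w) (hw_one : ∫⁻ g, w g ∂m = 1)
    (κ : Measure Z) [SFinite κ] [SMulInvariantMeasure G Z κ] {F : G → Z → ℝ≥0∞}
    (hF : Measurable (Function.uncurry F)) :
    ∫⁻ z, sectionSum C F z ∂κ = ∫⁻ y, ∫⁻ g, F g y ∂m ∂(transverseMeasure w κ C) := by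
  have hF' : Measurable fun y => ∫⁻ g, F g y ∂m := by
    exact (hF.comp measurable_swap).lintegral_prod_right'
  rw [lintegral_transverseMeasure hC hw κ hF']
  -- Left invariance replaces `g` by `h * g`. Translating `z` by `g` then turns the weight into `w
  -- (k * g⁻¹)`, whose integral over `g` is `1` since `m` is inversion invariant.
  have h₁ : ∀ z, sectionSum C (fun h y => w h * ∫⁻ g, F g y ∂m) z =
      ∫⁻ g, sectionSum C (fun h y => w h * F (h * g) y) z ∂m := by
    intro z
    rw [lintegral_sectionSum hC m z (f := fun g h y => w h * F (h * g) y)]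
    · refine sectionSum_congr fun h _ => ?_
      rw [lintegral_const_mul, lintegral_mul_left_eq_self (μ := m) (fun g => F g (h • z))]
      exact measurable_uncurry_apply hF (by fun_prop) (by fun_prop)
    · exact fun h => (measurable_uncurry_apply hF (by fun_prop) (by fun_prop)).const_mul _
  have hmeas : ∀ u : G × G × Z → G, Measurable u → Measurable fun p : G × Z =>
      sectionSum C (fun h y => w (u (p.1, h, y)) * F (h * p.1) y) p.2 := by
    intro u hu
    refine measurable_sectionSum hC measurable_snd
      (f := fun p h y => w (u (p.1, h, y)) * F (h * p.1) y) ?_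
    exact Measurable.mul (hw.comp (hu.comp (by fun_prop)))
      (measurable_uncurry_apply hF (by fun_prop) (by fun_prop))
  simp_rw [h₁]
  rw [lintegral_lintegral_swap]
  swap
  · exact ((hmeas (fun q => q.2.1) (by fun_prop)).comp measurable_swap).aemeasurable
  have h₂ : ∀ g : G, ∫⁻ z, sectionSum C (fun h y => w h * F (h * g) y) z ∂κ =
      ∫⁻ z, sectionSum C (fun k y => w (k * g⁻¹) * F k y) z ∂κ := by
    intro g
    rw [← (measurePreserving_smul g κ).lintegral_comp]
    · refine lintegral_congr fun z => ?_
      rw [sectionSum_smul]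
      simp
    · exact (hmeas (fun q => q.2.1) (by fun_prop)).comp measurable_prodMk_left
  simp_rw [h₂]
  rw [lintegral_lintegral_swap]
  swap
  · refine (measurable_sectionSum hC measurable_snd
      (f := fun (p : G × Z) k y => w (k * p.1⁻¹) * F k y) ?_).aemeasurable
    exact Measurable.mul (by fun_prop) (measurable_uncurry_apply hF (by fun_prop) (by fun_prop))
  refine lintegral_congr fun z => ?_
  rw [lintegral_sectionSum hC m z (f := fun g k y => w (k * g⁻¹) * F k y)]
  · refine sectionSum_congr fun k _ => ?_
    rw [lintegral_mul_const _ (show Measurable fun g => w (k * g⁻¹) by fun_prop),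
      lintegral_mul_inv_eq_one m hw_one, one_mul]
  · exact fun k => Measurable.mul_const (by fun_prop) _

/-- The mass transport principle for a measure `ν` carried by `C`. -/
def MassTransport (G : Type*) {Z : Type*} [Group G] [MeasurableSpace G] [MeasurableSpace Z]
    [MulAction G Z] (C : Set Z) (ν : Measure Z) : Prop :=
  ∀ H : G → Z → ℝ≥0∞, Measurable (Function.uncurry H) →
    ∫⁻ y, sectionSum C (fun g _ => H g y) y ∂ν = ∫⁻ y, sectionSum C (fun g y' => H g⁻¹ y') y ∂ν

/-- Unfolding the transverse measure gives a double sum over pairs of return times. Interchanging it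
and applying the Campbell formula leaves the factor `∫ w (g * k) dm(k) = 1`. -/
theorem massTransport_transverseMeasure [m.IsMulRightInvariant] {C : Set Z}
    (hC : IsLocFiniteSection G C) {w : G → ℝ≥0∞} (hw : Measurable w) (hw_one : ∫⁻ g, w g ∂m = 1)
    (κ : Measure Z) [SFinite κ] [SMulInvariantMeasure G Z κ] :
    MassTransport G C (transverseMeasure w κ C) := by
  intro H hH
  have hR : Measurable fun y => sectionSum C (fun (g : G) y' => H g⁻¹ y') y :=
    measurable_sectionSum_uncurry hC (f := fun g y' => H g⁻¹ y')
      (measurable_uncurry_apply hH (by fun_prop) (by fun_prop))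
  rw [lintegral_transverseMeasure hC hw κ hR]
  have hswap := fun z => sectionSum_comm C (fun (h k : G) _ y' => w h * H (h * k⁻¹) y') z
  simp only [mul_inv_rev, mul_inv_cancel_left, mul_inv_cancel_right] at hswap
  simp_rw [sectionSum_const_mul] at hswap
  simp_rw [hswap]
  rw [lintegral_sectionSum_eq_lintegral_transverseMeasure m hC hw hw_one κ]
  · refine lintegral_congr fun y => ?_
    rw [lintegral_sectionSum hC m y (f := fun k g _ => w (g * k) * H g y)]
    · refine sectionSum_congr fun g _ => ?_
      rw [lintegral_mul_const _ (show Measurable fun k => w (g * k) by fun_prop),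
        lintegral_mul_left_eq_self, hw_one, one_mul]
    · exact fun g => Measurable.mul_const (by fun_prop) _
  · refine measurable_sectionSum hC (φ := fun p : G × Z => p.2) measurable_snd
      (f := fun p g _ => w (g * p.1) * H g p.2) ?_
    exact Measurable.mul (by fun_prop) (measurable_uncurry_apply hH (by fun_prop) (by fun_prop))

/-- The transverse measure of a locally integrable cross section is finite. -/
theorem isFiniteMeasure_transverseMeasure {C : Set Z}
    (hC : IsLocFiniteSection G C) {w : G → ℝ≥0∞} (hw : Measurable w) (hw_one : ∫⁻ g, w g ∂m = 1)
    (κ : Measure Z) [SFinite κ] [SMulInvariantMeasure G Z κ]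
    (hint : ∀ K : Set G, IsCompact K →
      ∫⁻ z, (((returnTimes G C z ∩ K).encard : ℕ∞) : ℝ≥0∞) ∂κ < ∞) :
    IsFiniteMeasure (transverseMeasure w κ C) := by
  -- The Campbell formula for the indicator of `K` says that `m K` times the total transverse mass
  -- is the expected number of return times in `K`.
  obtain ⟨K, hK, hK1⟩ := exists_compact_mem_nhds (1 : G)
  have hmK : m K ≠ 0 := (m.measure_pos_of_mem_nhds hK1).ne'
  have hF : Measurable (Function.uncurry fun (g : G) (_ : Z) => K.indicator (1 : G → ℝ≥0∞) g) :=
    (measurable_one.indicator hK.measurableSet).comp measurable_fst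
  have h := lintegral_sectionSum_eq_lintegral_transverseMeasure m hC hw hw_one κ hF
  simp_rw [lintegral_indicator_one hK.measurableSet, lintegral_const] at h
  have hcount : ∀ z, sectionSum C (fun (g : G) _ => K.indicator (1 : G → ℝ≥0∞) g) z =
      (((returnTimes G C z ∩ K).encard : ℕ∞) : ℝ≥0∞) := by
    intro z
    have : ∀ g : G, C.indicator (fun _ => K.indicator (1 : G → ℝ≥0∞) g) (g • z) =
        (returnTimes G C z ∩ K).indicator (fun _ => 1) g := by
      intro g
      by_cases h₁ : g • z ∈ C <;> by_cases h₂ : g ∈ K <;> simp [returnTimes, h₁, h₂]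
    unfold sectionSum
    simp_rw [this]
    rw [← tsum_subtype, ENNReal.tsum_set_const, mul_one]
  simp_rw [hcount] at h
  have hlt := hint K hK
  rw [h] at hlt
  refine ⟨?_⟩
  by_contra htop
  rw [not_lt, top_le_iff] at htop
  rw [htop, ENNReal.mul_top hmK] at hlt
  exact lt_irrefl _ hlt

end Campbell

/-! ### From mass transport back to an invariant measure. -/

section InducedMeasure

variable {G Z : Type*} [Group G] [TopologicalSpace G] [IsTopologicalGroup G]
  [LocallyCompactSpace G] [SecondCountableTopology G] [T2Space G] [MeasurableSpace G]
  [BorelSpace G] [StandardBorelSpace G]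
  [MeasurableSpace Z] [StandardBorelSpace Z] [MulAction G Z] [MeasurableSMul₂ G Z]
  (m : Measure G) [m.IsHaarMeasure]

/-- The measure `f ↦ ∫ ∫ b g y * f (g⁻¹ • y) dm(g) dν(y)`. -/
def inducedMeasure {G Z : Type*} [Group G] [MeasurableSpace G] [MeasurableSpace Z] [MulAction G Z]
    (m : Measure G) (b : G → Z → ℝ≥0∞) (ν : Measure Z) : Measure Z :=
  ((ν.prod m).withDensity fun p => b p.2 p.1).map fun p => p.2⁻¹ • p.1

theorem lintegral_inducedMeasure {G Z : Type*} [Group G] [MeasurableSpace G] [MeasurableInv G]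
    [MeasurableSpace Z] [MulAction G Z] [MeasurableSMul₂ G Z] (m : Measure G) [SFinite m]
    {b : G → Z → ℝ≥0∞} (hb : Measurable (Function.uncurry b)) (ν : Measure Z) {f : Z → ℝ≥0∞}
    (hf : Measurable f) :
    ∫⁻ z, f z ∂(inducedMeasure m b ν) = ∫⁻ y, ∫⁻ g, b g y * f (g⁻¹ • y) ∂m ∂ν := by
  have hact : Measurable fun p : Z × G => p.2⁻¹ • p.1 := by fun_prop
  have hb' : Measurable fun p : Z × G => b p.2 p.1 :=
    measurable_uncurry_apply hb (by fun_prop) (by fun_prop)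
  unfold inducedMeasure
  have hfa : Measurable fun p : Z × G => f (p.2⁻¹ • p.1) := hf.comp hact
  rw [lintegral_map hf hact, lintegral_withDensity_eq_lintegral_mul _ hb' hfa,
    lintegral_prod _ (hb'.mul hfa).aemeasurable]
  rfl

variable {C : Set Z} (hC : IsLocFiniteSection G C) {b : G → Z → ℝ≥0∞}
  (hb : Measurable (Function.uncurry b)) (hb_one : ∀ z ∈ saturation G C, sectionSum C b z = 1)
  {ν : Measure Z} (hνC : ∀ᵐ y ∂ν, y ∈ C) (hν : MassTransport G C ν)

include hC hb hνC

theorem ae_mem_saturation_inducedMeasure :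
    ∀ᵐ z ∂(inducedMeasure m b ν), z ∈ saturation G C := by
  rw [ae_iff]
  change inducedMeasure m b ν (saturation G C)ᶜ = 0
  have hs := (measurableSet_saturation hC).compl
  rw [← lintegral_indicator_one hs,
    lintegral_inducedMeasure m hb ν (measurable_one.indicator hs)]
  refine lintegral_eq_zero_of_ae_eq_zero ?_
  filter_upwards [hνC] with y hy
  refine lintegral_eq_zero_of_ae_eq_zero (Filter.Eventually.of_forall fun g => ?_)
  simp [smul_mem_saturation hy g⁻¹]

include hb_one hν

/-- The Campbell formula for the induced measure. -/
theorem lintegral_sectionSum_inducedMeasure {F : G → Z → ℝ≥0∞}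
    (hF : Measurable (Function.uncurry F)) :
    ∫⁻ z, sectionSum C F z ∂(inducedMeasure m b ν) = ∫⁻ y, ∫⁻ g, F g y ∂m ∂ν := by
  rw [lintegral_inducedMeasure m hb ν (measurable_sectionSum_uncurry hC hF)]
  -- `H h y` is the contribution of the return time `h`. After transport and the substitution `g ↦ h
  -- * g`, the return time occurs only in `b (h * g) (h • y)`, which sums to `1` at the point `g⁻¹ •
  -- y`.
  let H : G → Z → ℝ≥0∞ := fun h y => ∫⁻ g, b g y * F (h * g) (h • y) ∂m
  have hH : Measurable (Function.uncurry H) := by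
    refine Measurable.lintegral_prod_right'
      (f := fun q : (G × Z) × G => b q.2 q.1.2 * F (q.1.1 * q.2) (q.1.1 • q.1.2)) ?_
    exact (measurable_uncurry_apply hb (by fun_prop) (by fun_prop)).mul
      (measurable_uncurry_apply hF (by fun_prop) (by fun_prop))
  have h₁ : ∀ y, ∫⁻ g, b g y * sectionSum C F (g⁻¹ • y) ∂m =
      sectionSum C (fun h _ => H h y) y := by
    intro y
    simp_rw [sectionSum_smul, inv_inv, ← sectionSum_const_mul]
    rw [lintegral_sectionSum hC m y (f := fun g k y' => b g y * F (k * g) y')]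
    · rfl
    · intro k
      exact (measurable_uncurry_apply hb (by fun_prop) (by fun_prop)).mul
        (measurable_uncurry_apply hF (by fun_prop) (by fun_prop))
  simp_rw [h₁]
  rw [hν H hH]
  refine lintegral_congr_ae ?_
  filter_upwards [hνC] with y hy
  have h₂ : sectionSum C (fun h y' => H h⁻¹ y') y =
      sectionSum C (fun h y' => ∫⁻ g, F g y * b (h * g) y' ∂m) y := by
    refine sectionSum_congr fun h _ => ?_
    simp only [H]
    rw [← lintegral_mul_left_eq_self (μ := m) _ h]
    refine lintegral_congr fun g => ?_
    rw [inv_mul_cancel_left, inv_smul_smul, mul_comm]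
  rw [h₂, ← lintegral_sectionSum hC m y (f := fun g h y' => F g y * b (h * g) y')]
  · refine lintegral_congr fun g => ?_
    have h₃ := sectionSum_smul C b g⁻¹ y
    rw [hb_one _ (smul_mem_saturation hy _), inv_inv] at h₃
    rw [sectionSum_const_mul C (fun h => b (h * g)), ← h₃, mul_one]
  · intro h
    exact (measurable_uncurry_apply hF (by fun_prop) (by fun_prop)).mul
      (measurable_uncurry_apply hb (by fun_prop) (by fun_prop))

/-- Summing a positive integrable function `u` on `G` over return times gives a density `S`,
positive on the saturation, with finite integral by the Campbell formula. -/
theorem sigmaFinite_inducedMeasure [IsFiniteMeasure ν] : SigmaFinite (inducedMeasure m b ν) := by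
  obtain ⟨u, hu_pos, hu, hu_int⟩ := exists_pos_lintegral_lt_of_sigmaFinite m one_ne_zero
  have hF : Measurable (Function.uncurry fun (g : G) (_ : Z) => (u g : ℝ≥0∞)) :=
    measurable_coe_nnreal_ennreal.comp (hu.comp measurable_fst)
  set S : Z → ℝ≥0∞ := sectionSum C fun g _ => (u g : ℝ≥0∞) with hS_def
  have hS : Measurable S := measurable_sectionSum_uncurry hC hF
  have hS_int : ∫⁻ z, S z ∂(inducedMeasure m b ν) ≠ ∞ := by
    rw [lintegral_sectionSum_inducedMeasure m hC hb hb_one hνC hν hF, lintegral_const]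
    exact ENNReal.mul_ne_top (hu_int.trans ENNReal.one_lt_top).ne (measure_ne_top _ _)
  have hS_zero : ∀ᵐ z ∂(inducedMeasure m b ν), S z ≠ 0 := by
    filter_upwards [ae_mem_saturation_inducedMeasure m hC hb hνC] with z hz h0
    obtain ⟨g, hg⟩ := mem_saturation_iff.1 hz
    have := sectionSum_eq_zero_iff.1 h0 g hg
    exact (hu_pos g).ne' (by exact_mod_cast this)
  have hS_top : ∀ᵐ z ∂(inducedMeasure m b ν), S z ≠ ∞ := by
    filter_upwards [ae_lt_top hS hS_int] with z hz using hz.ne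
  have : IsFiniteMeasure ((inducedMeasure m b ν).withDensity S) := isFiniteMeasure_withDensity hS_int
  rw [← withDensity_inv_same hS hS_zero hS_top]
  refine SigmaFinite.withDensity_of_ne_top ?_
  have := (withDensity_absolutelyContinuous (inducedMeasure m b ν) S).ae_le hS_zero
  filter_upwards [this] with z hz
  exact ENNReal.inv_ne_top.2 hz

variable [m.IsMulRightInvariant]

/-- Right invariance of `m` moves the translation by `c` into the weight, and `b (k * c)` still sums
to `1`, being `b` summed at `c⁻¹ • z`. -/
theorem smulInvariantMeasure_inducedMeasure :
    SMulInvariantMeasure G Z (inducedMeasure m b ν) := by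
  refine ⟨fun c s hs => ?_⟩
  have hf : Measurable (s.indicator (1 : Z → ℝ≥0∞)) := measurable_one.indicator hs
  have hfc : Measurable fun z : Z => s.indicator (1 : Z → ℝ≥0∞) (c • z) :=
    hf.comp (measurable_const_smul c)
  rw [← lintegral_indicator_one hs, ← lintegral_indicator_one (measurable_const_smul c hs)]
  change ∫⁻ z, s.indicator (1 : Z → ℝ≥0∞) (c • z) ∂_ = _
  rw [lintegral_inducedMeasure m hb ν hfc]
  have h₁ : ∀ y, ∫⁻ g, b g y * s.indicator (1 : Z → ℝ≥0∞) (c • g⁻¹ • y) ∂m =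
      ∫⁻ k, b (k * c) y * s.indicator (1 : Z → ℝ≥0∞) (k⁻¹ • y) ∂m := by
    intro y
    rw [← lintegral_mul_right_eq_self (μ := m) _ c]
    simp [smul_smul]
  simp_rw [h₁]
  rw [← lintegral_sectionSum_inducedMeasure m hC hb hb_one hνC hν
    (F := fun k y => b (k * c) y * s.indicator (1 : Z → ℝ≥0∞) (k⁻¹ • y))]
  · refine lintegral_congr_ae ?_
    filter_upwards [ae_mem_saturation_inducedMeasure m hC hb hνC] with z hz
    have h₂ := sectionSum_smul C b c⁻¹ z
    obtain ⟨g, y, hy, rfl⟩ := hz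
    rw [smul_smul, hb_one _ (smul_mem_saturation hy _), inv_inv] at h₂
    rw [← mul_one (s.indicator 1 (g • y)), h₂, ← sectionSum_const_mul]
    refine sectionSum_congr fun k _ => ?_
    rw [inv_smul_smul, mul_comm]
  · exact (measurable_uncurry_apply hb (by fun_prop) (by fun_prop)).mul (hf.comp (by fun_prop))

/-- A finite measure on the cross section which satisfies the mass transport principle is the
transverse measure of a `σ`-finite invariant measure. -/
theorem hasTransverseMeasure_inducedMeasure [IsFiniteMeasure ν] {w : G → ℝ≥0∞} (hw : Measurable w)
    (hw_one : ∫⁻ g, w g ∂m = 1) : HasTransverseMeasure w C ν (inducedMeasure m b ν) where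
  sigmaFinite := sigmaFinite_inducedMeasure m hC hb hb_one hνC hν
  invariant := smulInvariantMeasure_inducedMeasure m hC hb hb_one hνC hν
  carried := ae_mem_saturation_inducedMeasure m hC hb hνC
  transverse_eq := by
    ext s hs
    have hf : Measurable (s.indicator (1 : Z → ℝ≥0∞)) := measurable_one.indicator hs
    rw [← lintegral_indicator_one hs, lintegral_transverseMeasure hC hw _ hf,
      lintegral_sectionSum_inducedMeasure m hC hb hb_one hνC hν
        (F := fun g y => w g * s.indicator (1 : Z → ℝ≥0∞) y)
        ((hw.comp measurable_fst).mul (hf.comp measurable_snd)), ← lintegral_indicator_one hs]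
    refine lintegral_congr fun y => ?_
    rw [lintegral_mul_const _ hw, hw_one, one_mul]

end InducedMeasure

/-! ### Powers of the cross section and partial invariance. -/

section Powers

variable {G X : Type*} [Group G] [MulAction G X]

theorem returnTimes_crossPower (Y : Set X) (r : ℕ) (y : Fin r → X) :
    returnTimes G (crossPower Y r) y = ⋂ i, returnTimes G Y (y i) := by
  ext g
  simp [returnTimes, crossPower]

theorem sectionSum_crossPower_cons {Y : Set X} {n : ℕ} (f : G → (Fin (n + 1) → X) → ℝ≥0∞)
    (y : X) (y' : Fin n → X) :
    sectionSum (crossPower Y (n + 1)) f (Fin.cons y y' : Fin (n + 1) → X) =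
      sectionSum Y (fun g z => (crossPower Y n).indicator (fun z' => f g (Fin.cons z z'))
        (g • y')) y := by
  refine tsum_congr fun g => ?_
  have hsmul : g • (Fin.cons y y' : Fin (n + 1) → X) = Fin.cons (g • y) (g • y') := by
    ext i
    refine Fin.cases ?_ (fun i => ?_) i <;> simp
  have hmem : (Fin.cons (g • y) (g • y') : Fin (n + 1) → X) ∈ crossPower Y (n + 1) ↔
      g • y ∈ Y ∧ g • y' ∈ crossPower Y n := by
    simp [crossPower, Fin.forall_fin_succ]
  rw [hsmul]
  by_cases h₁ : g • y ∈ Y <;> by_cases h₂ : g • y' ∈ crossPower Y n <;>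
    simp [Set.indicator, hmem, h₁, h₂]

variable [MeasurableSpace X]

theorem measurableSet_crossPower {Y : Set X} (hY : MeasurableSet Y) (r : ℕ) :
    MeasurableSet (crossPower Y r) :=
  MeasurableSet.univ_pi fun _ => hY

theorem IsLocFiniteSection.crossPower [TopologicalSpace G] {Y : Set X}
    (hY : IsLocFiniteSection G Y) (n : ℕ) : IsLocFiniteSection G (crossPower Y (n + 1)) where
  measurableSet := measurableSet_crossPower hY.measurableSet _
  locFinite y := by
    rw [returnTimes_crossPower]
    exact (hY.locFinite (y 0)).mono (Set.iInter_subset _ 0)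

variable [MeasurableSpace G]

instance measurableSMul₂_pi {ι : Type*} [MeasurableSMul₂ G X] : MeasurableSMul₂ G (ι → X) :=
  ⟨measurable_pi_iff.2 fun i =>
    measurable_fst.smul ((measurable_pi_apply i).comp measurable_snd)⟩

/-- Every `g` maps the restriction of `ν` to `C ∩ g⁻¹C` to its restriction to `C ∩ gC`; this is
stated for measures carried by `C`. -/
def IsPartiallyInvariant (G : Type*) {Z : Type*} [Group G] [MeasurableSpace Z] [MulAction G Z]
    (C : Set Z) (ν : Measure Z) : Prop :=
  ∀ g : G, ν.restrict {y | g • y ∈ C} = (ν.restrict {y | g⁻¹ • y ∈ C}).map (g⁻¹ • ·)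

/-- Transport only along the single element `g`, starting in `s`: each sum has at most one nonzero
term. -/
theorem MassTransport.isPartiallyInvariant [MeasurableSingletonClass G] [MeasurableSMul G X]
    {C : Set X} (hC : MeasurableSet C) {ν : Measure X} (h : MassTransport G C ν) :
    IsPartiallyInvariant G C ν := by
  intro g
  ext s hs
  have hmeas : ∀ k : G, MeasurableSet {y : X | k • y ∈ C} := fun k => measurable_const_smul k hC
  rw [Measure.map_apply (measurable_const_smul g⁻¹) hs, Measure.restrict_apply hs,
    Measure.restrict_apply (measurable_const_smul g⁻¹ hs),
    ← lintegral_indicator_one (hs.inter (hmeas g)),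
    ← lintegral_indicator_one ((measurable_const_smul g⁻¹ hs).inter (hmeas g⁻¹))]
  have hH := h (fun k y => (({g} : Set G) ×ˢ s).indicator 1 (k, y))
    (measurable_one.indicator ((measurableSet_singleton g).prod hs))
  convert! hH using 1
  · refine lintegral_congr fun y => ?_
    unfold sectionSum
    rw [tsum_eq_single g]
    · by_cases h₁ : y ∈ s <;> by_cases h₂ : g • y ∈ C <;> simp [h₁, h₂]
    · intro k hk
      by_cases h₂ : k • y ∈ C <;> simp [h₂, hk]
  · refine lintegral_congr fun y => ?_
    unfold sectionSum
    rw [tsum_eq_single g⁻¹]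
    · by_cases h₁ : g⁻¹ • y ∈ s <;> by_cases h₂ : g⁻¹ • y ∈ C <;> simp [h₁, h₂]
    · intro k hk
      have hk' : k⁻¹ ≠ g := fun e => hk (by rw [← e, inv_inv])
      by_cases h₂ : k • y ∈ C <;> simp [h₂, hk']

/-- For a fixed `g` the condition equates restrictions to boxes and their pushforwards, so it
tensorizes directly. -/
theorem IsPartiallyInvariant.pi [MeasurableSMul G X] {Y : Set X} {ν : Measure X}
    [IsFiniteMeasure ν] (h : IsPartiallyInvariant G Y ν) (n : ℕ) :
    IsPartiallyInvariant G (crossPower Y n) (Measure.pi fun _ : Fin n => ν) := by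
  intro g
  have hset : ∀ k : G, {y : Fin n → X | k • y ∈ crossPower Y n} =
      Set.univ.pi fun _ => {y | k • y ∈ Y} := by
    intro k
    ext y
    simp [crossPower]
  rw [hset, hset, Measure.restrict_pi_pi, Measure.restrict_pi_pi]
  have hmap := Measure.pi_map_pi (μ := fun _ : Fin n => ν.restrict {y | g⁻¹ • y ∈ Y})
    (f := fun _ y => g⁻¹ • y) fun _ => (measurable_const_smul g⁻¹).aemeasurable
  simp_rw [← h g] at hmap
  exact hmap.symm

theorem IsPartiallyInvariant.lintegral_eq [MeasurableSMul G X] {C : Set X} (hC : MeasurableSet C)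
    {ν : Measure X} (h : IsPartiallyInvariant G C ν) (g : G) {φ : X → ℝ≥0∞} (hφ : Measurable φ) :
    ∫⁻ y, C.indicator (fun _ => φ y) (g • y) ∂ν = ∫⁻ y, C.indicator φ (g⁻¹ • y) ∂ν := by
  have hmeas : ∀ k : G, MeasurableSet {y : X | k • y ∈ C} := fun k => measurable_const_smul k hC
  change ∫⁻ y, {y | g • y ∈ C}.indicator φ y ∂ν =
    ∫⁻ y, {y | g⁻¹ • y ∈ C}.indicator (fun y => φ (g⁻¹ • y)) y ∂ν
  rw [lintegral_indicator (hmeas g), lintegral_indicator (hmeas g⁻¹), h g,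
    lintegral_map hφ (measurable_const_smul g⁻¹)]

theorem lintegral_pi_succ {ν : Measure X} [IsFiniteMeasure ν] (n : ℕ)
    {f : (Fin (n + 1) → X) → ℝ≥0∞} (hf : Measurable f) :
    ∫⁻ y, f y ∂(Measure.pi fun _ : Fin (n + 1) => ν) =
      ∫⁻ y, ∫⁻ y', f (Fin.cons y y') ∂(Measure.pi fun _ : Fin n => ν) ∂ν := by
  have h := (measurePreserving_piFinSuccAbove (fun _ : Fin (n + 1) => ν) 0).symm
  rw [← h.lintegral_comp hf]
  refine (lintegral_prod _ (hf.comp h.measurable).aemeasurable).trans ?_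
  simp [MeasurableEquiv.piFinSuccAbove_symm_apply, Fin.insertNthEquiv]

theorem measurable_indicator_smul [MeasurableSMul₂ G X] {C : Set X} (hC : MeasurableSet C)
    {β : Type*} [MeasurableSpace β] {l : β → G} {c : β → X} {F : β → ℝ≥0∞} (hl : Measurable l)
    (hc : Measurable c) (hF : Measurable F) :
    Measurable fun p => C.indicator (fun _ => F p) (l p • c p) := by
  change Measurable (((fun p => l p • c p) ⁻¹' C).indicator F)
  exact hF.indicator ((hl.smul hc) hC)

theorem measurable_cons {n : ℕ} {β : Type*} [MeasurableSpace β] {a : β → X} {c : β → Fin n → X}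
    (ha : Measurable a) (hc : Measurable c) :
    Measurable fun p => (Fin.cons (a p) (c p) : Fin (n + 1) → X) := by
  refine measurable_pi_iff.2 fun i => Fin.cases ?_ (fun i => ?_) i
  · simpa using ha
  · exact (measurable_pi_apply i).comp hc

end Powers

/-! ### Mass transport for powers. -/

section MassTransportPi

variable {G X : Type*} [Group G] [TopologicalSpace G] [IsTopologicalGroup G]
  [LocallyCompactSpace G] [SecondCountableTopology G] [T2Space G] [MeasurableSpace G]
  [BorelSpace G] [StandardBorelSpace G]
  [MeasurableSpace X] [StandardBorelSpace X] [MulAction G X] [MeasurableSMul₂ G X]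

/-- The mass transport principle passes to powers. -/
theorem MassTransport.pi {Y : Set X} (hY : IsLocFiniteSection G Y) {ν : Measure X}
    [IsFiniteMeasure ν] (h : MassTransport G Y ν) (n : ℕ) :
    MassTransport G (crossPower Y (n + 1)) (Measure.pi fun _ : Fin (n + 1) => ν) := by
  intro H hH
  have hC := hY.crossPower n
  have hC' : MeasurableSet (crossPower Y n) := measurableSet_crossPower hY.measurableSet n
  have hinv := (h.isPartiallyInvariant hY.measurableSet).pi n
  rw [lintegral_pi_succ, lintegral_pi_succ]
  rotate_left
  · exact measurable_sectionSum_uncurry hC (f := fun g y' => H g⁻¹ y')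
      (measurable_uncurry_apply hH (by fun_prop) (by fun_prop))
  · exact measurable_sectionSum hC measurable_id (f := fun y g _ => H g y)
      (measurable_uncurry_apply hH (by fun_prop) (by fun_prop))
  -- Integrating out all coordinates but the first leaves a transport on `Y`. Full mass transport is
  -- needed only there; for each fixed `g` the other coordinates are handled by partial invariance.
  let K : G → X → ℝ≥0∞ := fun g y => ∫⁻ y', (crossPower Y n).indicator
    (fun _ => H g (Fin.cons y y')) (g • y') ∂(Measure.pi fun _ : Fin n => ν)
  have hK : Measurable (Function.uncurry K) :=
    Measurable.lintegral_prod_right' (f := fun q : (G × X) × (Fin n → X) =>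
      (crossPower Y n).indicator (fun _ => H q.1.1 (Fin.cons q.1.2 q.2)) (q.1.1 • q.2))
      (measurable_indicator_smul hC' (by fun_prop) (by fun_prop) (measurable_uncurry_apply hH
        (by fun_prop) (measurable_cons (by fun_prop) (by fun_prop))))
  have hL : ∀ y, ∫⁻ y', sectionSum (crossPower Y (n + 1))
      (fun (g : G) _ => H g (Fin.cons y y')) (Fin.cons y y' : Fin (n + 1) → X)
      ∂(Measure.pi fun _ : Fin n => ν) = sectionSum Y (fun g _ => K g y) y := by
    intro y
    simp_rw [sectionSum_crossPower_cons]
    exact lintegral_sectionSum hY _ y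
      (f := fun y' g _ => (crossPower Y n).indicator (fun _ => H g (Fin.cons y y')) (g • y'))
      fun g => measurable_indicator_smul hC' measurable_const measurable_id
        (measurable_uncurry_apply hH measurable_const
          (measurable_cons measurable_const measurable_id))
  have hR : ∀ y, ∫⁻ y', sectionSum (crossPower Y (n + 1))
      (fun (g : G) z => H g⁻¹ z) (Fin.cons y y' : Fin (n + 1) → X)
      ∂(Measure.pi fun _ : Fin n => ν) = sectionSum Y (fun g z => K g⁻¹ z) y := by
    intro y
    simp_rw [sectionSum_crossPower_cons]
    rw [lintegral_sectionSum hY _ y (f := fun y' g z =>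
      (crossPower Y n).indicator (fun z' => H g⁻¹ (Fin.cons z z')) (g • y'))]
    · refine sectionSum_congr fun g _ => ?_
      have := hinv.lintegral_eq hC' g⁻¹ (φ := fun z' => H g⁻¹ (Fin.cons (g • y) z'))
        (measurable_uncurry_apply hH measurable_const
          (measurable_cons measurable_const measurable_id))
      rw [inv_inv] at this
      exact this.symm
    · intro g
      exact measurable_indicator_smul hC' measurable_const measurable_id
        (F := fun y' => H g⁻¹ (Fin.cons (g • y) (g • y')))
        (measurable_uncurry_apply hH measurable_const
          (measurable_cons measurable_const (measurable_const_smul g)))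
  simp_rw [hL, hR]
  exact h K hK

end MassTransportPi

/-! ### Voronoi weights. -/

section Voronoi

theorem IsLocFinite.of_finite {G : Type*} [TopologicalSpace G] {P : Set G} (hP : P.Finite) :
    IsLocFinite P :=
  fun _ _ => hP.subset Set.inter_subset_left

variable {G : Type*} [Group G] [TopologicalSpace G] [MeasurableSpace G] {d : G → G → ℝ}
  {Θ : Set G → G → Set G}

/-- The cells are determined by those of two-point configurations. -/
theorem IsVoronoiScheme.mem_cell_one_iff (hΘ : IsVoronoiScheme d Θ) {P : Set G}
    (hP : IsLocFinite P) (h1 : (1 : G) ∈ P) (x : G) :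
    x ∈ Θ P 1 ↔ ∀ q ∈ P, x ∈ Θ {1, q} 1 := by
  have hpair : ∀ q : G, IsLocFinite ({1, q} : Set G) := fun q =>
    IsLocFinite.of_finite (Set.toFinite _)
  have hsub : ∀ q ∈ P, ({1, q} : Set G) ⊆ P := by
    rintro q hq p (rfl | rfl)
    exacts [h1, hq]
  constructor
  · intro hx q hq
    exact hΘ.anti _ _ (hpair q) hP (hsub q hq) 1 (Or.inl rfl) hx
  · intro hx
    obtain ⟨p, ⟨hpP, hxp⟩, -⟩ := hΘ.partition P hP ⟨1, h1⟩ x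
    have hxp' := hΘ.anti _ _ (hpair p) hP (hsub p hpP) p (Or.inr rfl) hxp
    -- If `p` owns `x` in `P`, it also owns `x` in `{1, p}`, where `1` owns `x` by assumption; hence
    -- `p = 1`.
    have := (hΘ.partition _ (hpair p) ⟨1, Or.inl rfl⟩ x).unique
      ⟨Or.inl rfl, hx p hpP⟩ ⟨Or.inr rfl, hxp'⟩
    rwa [this]

theorem IsVoronoiScheme.one_mem_cell_iff (hΘ : IsVoronoiScheme d Θ) {P : Set G}
    (hP : IsLocFinite P) {g : G} (hg : g ∈ P) :
    g⁻¹ ∈ Θ ((fun x => x * g⁻¹) '' P) 1 ↔ 1 ∈ Θ P g := by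
  have := hΘ.equivariant P hP g hg g⁻¹
  rw [mul_inv_cancel] at this
  rw [this]
  simp

variable {Z : Type*} [MulAction G Z]

open Classical in
/-- The indicator function of `g⁻¹` lying in the Voronoi cell of `1` for the return times of `y`,
expressed through the cells of two-point configurations. -/
def voronoiWeight (Θ : Set G → G → Set G) (C : Set Z) (g : G) (y : Z) : ℝ≥0∞ :=
  if sectionSum C (fun q _ => {t : G × G | t.1 ∈ Θ {1, t.2} 1}ᶜ.indicator 1 (g⁻¹, q)) y = 0
  then 1 else 0

theorem IsVoronoiScheme.voronoiWeight_eq [MeasurableSpace Z] (hΘ : IsVoronoiScheme d Θ)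
    {C : Set Z} (hC : IsLocFiniteSection G C) {y : Z} (hy : y ∈ C) (g : G) :
    voronoiWeight Θ C g y = (Θ (returnTimes G C y) 1).indicator 1 g⁻¹ := by
  classical
  have h1 : (1 : G) ∈ returnTimes G C y := by simpa [returnTimes] using hy
  unfold voronoiWeight
  rw [Set.indicator_apply]
  refine if_congr ?_ rfl rfl
  rw [hΘ.mem_cell_one_iff (hC.locFinite y) h1, sectionSum_eq_zero_iff]
  refine forall_congr' fun q => forall_congr' fun _ => ?_
  simp

theorem IsVoronoiScheme.sectionSum_voronoiWeight [MeasurableSpace Z] (hΘ : IsVoronoiScheme d Θ)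
    {C : Set Z} (hC : IsLocFiniteSection G C) {z : Z} (hz : z ∈ saturation G C) :
    sectionSum C (voronoiWeight Θ C) z = 1 := by
  obtain ⟨g₀, hg₀⟩ := mem_saturation_iff.1 hz
  obtain ⟨p, ⟨hp, h1p⟩, hpu⟩ := hΘ.partition (returnTimes G C z) (hC.locFinite z) ⟨g₀, hg₀⟩ 1
  have key : ∀ g : G, g • z ∈ C → (g⁻¹ ∈ Θ (returnTimes G C (g • z)) 1 ↔
      1 ∈ Θ (returnTimes G C z) g) := by
    intro g hg
    rw [← hΘ.one_mem_cell_iff (hC.locFinite z) hg]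
    have : returnTimes G C (g • z) = (fun x => x * g⁻¹) '' returnTimes G C z := by
      ext k
      simp [returnTimes, smul_smul]
    rw [this]
  have hterm : ∀ g : G, g • z ∈ C → voronoiWeight Θ C g (g • z) =
      {g | 1 ∈ Θ (returnTimes G C z) g}.indicator 1 g := by
    intro g hg
    rw [hΘ.voronoiWeight_eq hC hg]
    by_cases h : 1 ∈ Θ (returnTimes G C z) g
    · simp [(key g hg).2 h, h]
    · simp [mt (key g hg).1 h, h]
  unfold sectionSum
  rw [tsum_eq_single p]
  · have hp' : p • z ∈ C := hp
    rw [Set.indicator_of_mem hp', hterm p hp']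
    simp [h1p]
  · intro g hg
    by_cases hgC : g • z ∈ C
    · rw [Set.indicator_of_mem hgC, hterm g hgC]
      have h : 1 ∉ Θ (returnTimes G C z) g := fun h => hg (hpu g ⟨hgC, h⟩)
      simp [h]
    · exact Set.indicator_of_notMem hgC _

theorem IsVoronoiScheme.lintegral_voronoiWeight (hΘ : IsVoronoiScheme d Θ) (m : Measure G)
    [MeasurableInv G] [m.IsInvInvariant] [MeasurableSpace Z] {C : Set Z}
    (hC : IsLocFiniteSection G C) {y : Z} (hy : y ∈ C) :
    ∫⁻ g, voronoiWeight Θ C g y ∂m = m (Θ (returnTimes G C y) 1) := by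
  have h1 : (1 : G) ∈ returnTimes G C y := by simpa [returnTimes] using hy
  simp_rw [hΘ.voronoiWeight_eq hC hy]
  rw [lintegral_inv_eq_self (μ := m) fun g => (Θ (returnTimes G C y) 1).indicator 1 g,
    lintegral_indicator_one (hΘ.measurableSet_cell _ (hC.locFinite y) 1 h1)]

end Voronoi

/-! ### Kac's lemma for a general cross section. -/

section Kac

variable {G Z : Type*} [Group G] [TopologicalSpace G] [IsTopologicalGroup G]
  [LocallyCompactSpace G] [SecondCountableTopology G] [T2Space G] [MeasurableSpace G]
  [BorelSpace G] [StandardBorelSpace G]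
  [MeasurableSpace Z] [StandardBorelSpace Z] [MulAction G Z] [MeasurableSMul₂ G Z]
  {d : G → G → ℝ} {Θ : Set G → G → Set G}

theorem IsVoronoiScheme.measurable_voronoiWeight (hΘ : IsVoronoiScheme d Θ) {C : Set Z}
    (hC : IsLocFiniteSection G C) : Measurable (Function.uncurry (voronoiWeight Θ C)) := by
  have h : Measurable fun p : G × Z => sectionSum C
      (fun q _ => {t : G × G | t.1 ∈ Θ {1, t.2} 1}ᶜ.indicator (1 : G × G → ℝ≥0∞) (p.1⁻¹, q)) p.2 := by
    refine measurable_sectionSum hC measurable_snd (f := fun (p : G × Z) q _ =>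
      {t : G × G | t.1 ∈ Θ {1, t.2} 1}ᶜ.indicator (1 : G × G → ℝ≥0∞) (p.1⁻¹, q)) ?_
    exact (measurable_one.indicator hΘ.borel.compl).comp (by fun_prop)
  exact Measurable.ite (h (measurableSet_singleton 0)) measurable_const measurable_const

/-- Kac's lemma: the mass of an invariant measure is the integral of the volumes of the Voronoi
cells against the transverse measure. -/
theorem IsVoronoiScheme.measure_saturation_eq_lintegral (hΘ : IsVoronoiScheme d Θ)
    (m : Measure G) [m.IsHaarMeasure] [m.IsInvInvariant] {C : Set Z}
    (hC : IsLocFiniteSection G C) {w : G → ℝ≥0∞} (hw : Measurable w) (hw_one : ∫⁻ g, w g ∂m = 1)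
    {κ ν : Measure Z} (h : HasTransverseMeasure w C ν κ) :
    κ (saturation G C) = ∫⁻ y in C, m (Θ (returnTimes G C y) 1) ∂ν := by
  have := h.sigmaFinite
  have := h.invariant
  have hb := hΘ.measurable_voronoiWeight hC
  have hν : ∀ᵐ y ∂ν, y ∈ C := h.transverse_eq ▸ ae_mem_transverseMeasure hC hw κ
  rw [Measure.restrict_eq_self_of_ae_mem hν]
  calc κ (saturation G C) = ∫⁻ _, 1 ∂κ := by
        rw [lintegral_one]
        exact measure_congr (ae_eq_univ.2 h.carried)
    _ = ∫⁻ z, sectionSum C (voronoiWeight Θ C) z ∂κ := by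
        refine lintegral_congr_ae ?_
        filter_upwards [h.carried] with z hz
        rw [hΘ.sectionSum_voronoiWeight hC hz]
    _ = ∫⁻ y, ∫⁻ g, voronoiWeight Θ C g y ∂m ∂ν := by
        rw [lintegral_sectionSum_eq_lintegral_transverseMeasure m hC hw hw_one κ hb,
          h.transverse_eq]
    _ = ∫⁻ y, m (Θ (returnTimes G C y) 1) ∂ν := by
        refine lintegral_congr_ae ?_
        filter_upwards [hν] with y hy
        exact hΘ.lintegral_voronoiWeight m hC hy

/-- The integrated Voronoi weight is a Borel function on all of `Z` that agrees with the cell volume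
on `C`. -/
theorem IsVoronoiScheme.aemeasurable_measure_cell (hΘ : IsVoronoiScheme d Θ)
    (m : Measure G) [SFinite m] [m.IsInvInvariant] {C : Set Z} (hC : IsLocFiniteSection G C)
    (ν : Measure Z) :
    AEMeasurable (fun y => m (Θ (returnTimes G C y) 1)) (ν.restrict C) := by
  refine ⟨fun y => ∫⁻ g, voronoiWeight Θ C g y ∂m,
    ((hΘ.measurable_voronoiWeight hC).comp measurable_swap).lintegral_prod_right', ?_⟩
  filter_upwards [ae_restrict_mem hC.measurableSet] with y hy
  exact (hΘ.lintegral_voronoiWeight m hC hy).symm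

end Kac

/-! ### Consequences of the hypotheses on the group and the cross section. -/

section Groups

variable {G : Type*} [Group G] [TopologicalSpace G]

/-- A proper metric is complete. The standard Borel structure on `G` used in the uniformization
comes from here. -/
theorem IsCompatibleMetric.polishSpace [SecondCountableTopology G] {d : G → G → ℝ}
    (hd : IsCompatibleMetric d) : PolishSpace G := by
  let : MetricSpace G := MetricSpace.ofDistTopology d (fun x => (hd.eq_zero_iff x x).2 rfl) hd.symm
    hd.triangle
    (fun s => by
      rw [isOpen_iff_mem_nhds]
      refine forall_congr' fun x => forall_congr' fun _ => ?_
      rw [hd.mem_nhds_iff]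
      rfl)
    (fun x y => (hd.eq_zero_iff x y).1)
  have : ProperSpace G := ⟨fun x R => by
    convert! hd.proper x R using 1
    ext y
    change d y x ≤ R ↔ d x y ≤ R
    rw [hd.symm]⟩
  infer_instance

/-- A bi-invariant Haar measure is invariant under inversion. -/
theorem isInvInvariant_of_isMulRightInvariant [IsTopologicalGroup G] [LocallyCompactSpace G]
    [SecondCountableTopology G] [MeasurableSpace G] [BorelSpace G] (m : Measure G)
    [m.IsHaarMeasure] [m.IsMulRightInvariant] : m.IsInvInvariant := by
  constructor
  let c : ℝ≥0∞ := m.inv.haarScalarFactor m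
  have hc : m.inv = c • m := Measure.isMulLeftInvariant_eq_smul m.inv m
  -- Inverting twice is the identity, so the scaling factor squares to `1`.
  have hcc : m = c ^ 2 • m := by
    conv_lhs => rw [← Measure.inv_inv m, hc, Measure.inv_def, Measure.map_smul,
      ← Measure.inv_def, hc, smul_smul, ← pow_two]
  have K : TopologicalSpace.PositiveCompacts G := Classical.arbitrary _
  have h₁ : c ^ 2 * m K = 1 ^ 2 * m K := by
    conv_rhs => rw [hcc]
    simp
  have h₂ : c ^ 2 = 1 ^ 2 :=
    (ENNReal.mul_left_inj (Measure.measure_pos_of_nonempty_interior m K.interior_nonempty).ne'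
      K.isCompact.measure_lt_top.ne).1 h₁
  have h₃ : c = 1 := (ENNReal.pow_right_strictMono two_ne_zero).injective h₂
  rw [hc, h₃, one_smul]

theorem IsLocallyIntegrableCrossSection.isLocFiniteSection {X : Type*} [MeasurableSpace X]
    [MulAction G X] {μ : Measure X} {Y : Set X} (hY : IsLocallyIntegrableCrossSection G μ Y) :
    IsLocFiniteSection G Y where
  measurableSet := hY.measurableSet
  locFinite z := by
    by_cases hz : z ∈ saturation G Y
    · exact hY.locFinite z hz
    · have : returnTimes G Y z = ∅ :=
        Set.eq_empty_of_forall_notMem fun g hg => hz (mem_saturation_iff.2 ⟨g, hg⟩)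
      rw [this]
      exact fun K _ => by simp

end Groups

end TransverseKac

end

open TransverseKac in
theorem mainTheorem7
    {G : Type*} [Group G] [TopologicalSpace G] [IsTopologicalGroup G] [LocallyCompactSpace G]
    [SecondCountableTopology G] [T2Space G] [MeasurableSpace G] [BorelSpace G]
    (m : Measure G) [m.IsHaarMeasure] [m.IsMulRightInvariant]
    {X : Type*} [MeasurableSpace X] [StandardBorelSpace X] [MulAction G X] [MeasurableSMul₂ G X]
    (μ : Measure X) [IsProbabilityMeasure μ] [SMulInvariantMeasure G X μ]
    (Y : Set X) (hY : TransverseKac.IsLocallyIntegrableCrossSection G μ Y)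
    (w : G → ℝ≥0∞) (hw : Measurable w) (hw_one : ∫⁻ g, w g ∂m = 1)
    (d : G → G → ℝ) (hd : TransverseKac.IsCompatibleMetric d)
    (Θ : Set G → G → Set G) (hΘ : TransverseKac.IsVoronoiScheme d Θ)
    (r : ℕ) (hr : 1 ≤ r) :
    AEMeasurable (fun y : Fin r → X => m (Θ (⋂ i, TransverseKac.returnTimes G Y (y i)) 1))
        ((TransverseKac.transversePower w μ Y r).restrict (TransverseKac.crossPower Y r)) ∧
      TransverseKac.intersectionCovolume w μ Y r =
        ∫⁻ y in TransverseKac.crossPower Y r,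
          m (Θ (⋂ i, TransverseKac.returnTimes G Y (y i)) 1)
            ∂(TransverseKac.transversePower w μ Y r) := by
  -- A first coordinate is needed for the return times to be locally finite; for `r = 0` they would
  -- be all of `G`.
  obtain ⟨n, rfl⟩ : ∃ n, r = n + 1 := ⟨r - 1, by omega⟩
  have := hd.polishSpace
  have := isInvInvariant_of_isMulRightInvariant m
  have hY' := hY.isLocFiniteSection
  have hC := hY'.crossPower n
  have := isFiniteMeasure_transverseMeasure m hY' hw hw_one μ hY.locIntegrable
  have hmass := (massTransport_transverseMeasure m hY' hw hw_one μ).pi hY' n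
  have hcarried : ∀ᵐ y ∂(transversePower w μ Y (n + 1)), y ∈ crossPower Y (n + 1) := by
    have : ∀ᵐ y ∂(transversePower w μ Y (n + 1)), ∀ i, y i ∈ Y :=
      ae_all_iff.2 fun i =>
        (Measure.quasiMeasurePreserving_eval (fun _ => transverseMeasure w μ Y) i).ae
          (ae_mem_transverseMeasure hY' hw μ)
    filter_upwards [this] with y hy i _ using hy i
  have : IsFiniteMeasure (transversePower w μ Y (n + 1)) := by
    unfold transversePower
    infer_instance
  have hex : ∃ M, HasTransverseMeasure w (crossPower Y (n + 1)) (transversePower w μ Y (n + 1)) M :=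
    ⟨_, hasTransverseMeasure_inducedMeasure m hC (hΘ.measurable_voronoiWeight hC)
      (fun z hz => hΘ.sectionSum_voronoiWeight hC hz) hcarried hmass hw hw_one⟩
  have hM : HasTransverseMeasure w (crossPower Y (n + 1)) (transversePower w μ Y (n + 1))
      (intersectionMeasure w μ Y (n + 1)) := by
    unfold intersectionMeasure inverseTransverse
    -- Existence excludes the default value `0`. Kac's formula holds for every measure with this
    -- transverse measure, so it does not matter which one is chosen.
    rw [dif_pos hex]
    exact hex.choose_spec
  simp_rw [← returnTimes_crossPower]
  exact ⟨hΘ.aemeasurable_measure_cell m hC _,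
    hΘ.measure_saturation_eq_lintegral m hC hw hw_one hM⟩
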